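/- Let $\nu>0$ and let $h:[0,1]\to[1,+\infty)$ be a $C^1$-function. Let $\mathcal P(\mathbb N)$ be the set of probability distributions on $\mathbb N=\{0,1,2,\ldots\}$, and write $\langle\mu,f\rangle=\sum_{n}\mu(n)f(n)$. The non-linear $M/M/1$ dynamics with arrival rate $1$ and service rate $\nu h(\Gamma(t)(0))$ is the dynamical system on $\mathcal P(\mathbb N)$ whose trajectories are the functions $\Gamma:[0,\infty)\to\mathcal P(\mathbb N)$ such that, for all $t\ge 0$ and all $f:\mathbb N\to\mathbb R_+$ with finite support, $$\frac{d}{dt}\langle\Gamma(t),f\rangle=\langle\Gamma(t),\nabla^+f\rangle+\nu h(\Gamma(t)(0))\,\langle\Gamma(t),\nabla^-f\rangle,\qquad(\mathrm{MNL})$$ where $\nabla^+f(x)=f(x+1)-f(x)$ and $\nabla^-f(x)=(f(x-1)-f(x))\mathbf 1_{\{x>0\}}$ (at $t=0$ the derivative is the right derivative). **Theorem.** Suppose that $S\in(0,1)$ satisfies $S=1-\dfrac1{\nu h(S)}$ and $$|h'(S)|<\frac1{\nu S}\left(\frac1{\sqrt{1-S}}-1\right)^2 .$$ Then the geometric distribution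 $$\pi_S(n)=\left(\frac1{\nu h(S)}\right)^n\left(1-\frac1{\nu h(S)}\right),\qquad n\in\mathbb N,$$ is an exponentially stable equilibrium point of (MNL) for the weighted $L^2$ distance $$\|\mu-\pi_S\|_2=\left(\sum_{n\in\mathbb N}\left(\frac{\mu(n)}{\pi_S(n)}-1\right)^2\pi_S(n)\right)^{1/2}\in[0,\infty].$$ That is, $\pi_S\in\mathcal P(\mathbb N)$, the constant trajectory $\Gamma(t)\equiv\pi_S$ satisfies (MNL), and there exist constants $q>0$ and $\varepsilon>0$, depending only on $\nu$, $h$ and $S$, such that every trajectory $\Gamma$ of (MNL) with $\|\Gamma(0)-\pi_S\|_2\le\varepsilon$ satisfies $$\|\Gamma(t)-\pi_S\|_2^2\le\|\Gamma(0)-\pi_S\|_2^2\,e^{-qt}\qquad\text{for all }t\ge0 .$$ -/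

import Mathlib

open scoped ENNReal

noncomputable section

/-- The set `𝒫(ℕ)` of probability distributions on `ℕ`. -/
def probDist : Set (ℕ → ℝ) := {μ | (∀ n, 0 ≤ μ n) ∧ HasSum μ 1}

/-- The pairing `⟨μ, f⟩ = ∑ₙ μ(n) f(n)`. -/
def pairing (μ f : ℕ → ℝ) : ℝ := ∑' n, μ n * f n

/-- `∇⁺(f)(x) = f(x+1) - f(x)`. -/
def gradPlus (f : ℕ → ℝ) (x : ℕ) : ℝ := f (x + 1) - f x

/-- `∇⁻(f)(x) = (f(x-1) - f(x)) 𝟙{x > 0}`. -/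
def gradMinus (f : ℕ → ℝ) (x : ℕ) : ℝ := if 0 < x then f (x - 1) - f x else 0

/-- `Γ : [0,∞) → 𝒫(ℕ)` (only times `t ≥ 0` matter) is a solution of the non-linear `M/M/1`
dynamics with arrival rate `1` and service rate `ν h(Γ(t)(0))`:
`d/dt ⟨Γ(t), f⟩ = ⟨Γ(t), ∇⁺ f⟩ + ν h(Γ(t)(0)) ⟨Γ(t), ∇⁻ f⟩`
for every `t ≥ 0` and every `f : ℕ → ℝ₊` with finite support
(the derivative at `t = 0` is the right derivative). -/
structure IsNonlinearMM1Solution (ν : ℝ) (h : ℝ → ℝ) (Γ : ℝ → ℕ → ℝ) : Prop where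
  mem_probDist : ∀ t, 0 ≤ t → Γ t ∈ probDist
  hasDeriv : ∀ f : ℕ → ℝ, (∀ n, 0 ≤ f n) → f.support.Finite → ∀ t, 0 ≤ t →
    HasDerivWithinAt (fun s => pairing (Γ s) f)
      (pairing (Γ t) (gradPlus f) + ν * h (Γ t 0) * pairing (Γ t) (gradMinus f))
      (Set.Ici 0) t

/-- An equilibrium point: a probability distribution which, as a constant trajectory, solves the
dynamics. -/
def IsEquilibriumPoint (ν : ℝ) (h : ℝ → ℝ) (μ : ℕ → ℝ) : Prop :=
  IsNonlinearMM1Solution ν h (fun _ => μ)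

/-- `π_S(n) = (1/(ν h(S)))ⁿ (1 - 1/(ν h(S)))`. -/
def piS (ν : ℝ) (h : ℝ → ℝ) (S : ℝ) (n : ℕ) : ℝ :=
  (1 / (ν * h S)) ^ n * (1 - 1 / (ν * h S))

/-- The weighted `L²` distance `‖μ - π‖₂ = (∑ₙ (μ(n)/π(n) - 1)² π(n))^{1/2}`, with values in
`[0,∞]`, for a positive reference distribution `π`. -/
def l2Dist (μ π : ℕ → ℝ) : ℝ≥0∞ :=
  (∑' n, ENNReal.ofReal ((μ n / π n - 1) ^ 2 * π n)) ^ (1 / 2 : ℝ)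

/-- `π` is an exponentially stable equilibrium point of the non-linear `M/M/1` dynamics for the
distance `‖· - π‖₂`. -/
def IsExponentiallyStableEquilibrium (ν : ℝ) (h : ℝ → ℝ) (π : ℕ → ℝ) : Prop :=
  IsEquilibriumPoint ν h π ∧
    ∃ q > (0 : ℝ), ∃ ε > (0 : ℝ), ∀ Γ : ℝ → ℕ → ℝ, IsNonlinearMM1Solution ν h Γ →
      l2Dist (Γ 0) π ≤ ENNReal.ofReal ε →
        ∀ t, 0 ≤ t →
          l2Dist (Γ t) π ^ 2 ≤ l2Dist (Γ 0) π ^ 2 * ENNReal.ofReal (Real.exp (-q * t))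

end

/-! With `ρ = 1 - S = 1/(ν h(S))` and `r = ρ^(-1/2)`, the squared distance is `(1-ρ)⁻¹` times the
energy `∑ ρ⁻ⁿ uₙ²` of the deviation `u`. Put `xₙ = ρ⁻ⁿ uₙ` and `c = 1 - ν h(Γ(t)(0)) ρ`. Summation
by parts shows that half the derivative of the energy is the Dirichlet form `-∑ ρⁿ (xₙ₊₁ - xₙ)²` of
the linear queue, plus terms carrying `c`. Since `∑ ρⁿ xₙ = 0`, a discrete Hardy inequality
(`geometric_hardy`) bounds the Dirichlet form below by `(r-1)²` times the energy. As `c` is of order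
`ν ρ |h'(S)| |x₀|`, the term linear in `c` costs at most about `ν S |h'(S)| x₀²`, while the rest is
cubic in the deviation. The slope hypothesis says exactly that `ν S |h'(S)| < (r-1)²`.

The equation is tested on finitely supported functions only, so every energy has to be truncated.
`geomEnergy_growth` first propagates finiteness of the energy at a crude exponential rate, with
weights that decay at infinity. Given a uniform energy bound, `cutoffEnergy_dissipation` and
`geomEnergy_decay` recover the sharp rate with a linear cutoff of slope `1/N`, whose error is
`O(1/N)`. No continuity of the full energy in time is used: the crude bound keeps small data small
on a unit interval, the sharp bound makes the energy shrink there, and the argument restarts. -/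

/-! ### Flux form of the equations for the point masses -/

-- Here `J n` plays the net flux from `n` to `n + 1`, with no flux into `0` from below; the last
-- term is the flux through the truncation.
open Finset in
theorem sum_mul_flux_sub (a J D : ℕ → ℝ) (h0 : D 0 = -J 0) (hs : ∀ n, D (n + 1) = J n - J (n + 1))
    (N : ℕ) :
    ∑ n ∈ range (N + 1), a n * D n = ∑ n ∈ range N, (a (n + 1) - a n) * J n - a N * J N := by
  induction N with
  | zero => simp [h0]
  | succ N ih => rw [sum_range_succ, ih, hs, sum_range_succ]; ring

theorem pairing_single (μ : ℕ → ℝ) (n : ℕ) : pairing μ (Pi.single n 1) = μ n := by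
  unfold pairing
  rw [tsum_eq_single n]
  · simp
  · intro k hk; simp [hk]

theorem pairing_gradPlus_single_zero (μ : ℕ → ℝ) :
    pairing μ (gradPlus (Pi.single 0 1)) = -μ 0 := by
  unfold pairing
  rw [tsum_eq_single 0]
  · simp [gradPlus]
  · intro k hk; simp [gradPlus, hk]

theorem pairing_gradPlus_single_succ (μ : ℕ → ℝ) (n : ℕ) :
    pairing μ (gradPlus (Pi.single (n + 1) 1)) = μ n - μ (n + 1) := by
  unfold pairing
  rw [tsum_eq_sum (s := {n, n + 1})]
  · rw [Finset.sum_pair (by simp)]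
    simp [gradPlus]; ring
  · intro k hk
    simp only [Finset.mem_insert, Finset.mem_singleton, not_or] at hk
    simp [gradPlus, hk.1, hk.2]

theorem pairing_gradMinus_single_zero (μ : ℕ → ℝ) :
    pairing μ (gradMinus (Pi.single 0 1)) = μ 1 := by
  unfold pairing
  rw [tsum_eq_single 1]
  · simp [gradMinus]
  · intro k hk
    rcases k with _ | k
    · simp [gradMinus]
    · have : k ≠ 0 := by rintro rfl; simp at hk
      simp [gradMinus, this]

theorem pairing_gradMinus_single_succ (μ : ℕ → ℝ) (n : ℕ) :
    pairing μ (gradMinus (Pi.single (n + 1) 1)) = μ (n + 2) - μ (n + 1) := by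
  unfold pairing
  rw [tsum_eq_sum (s := {n + 1, n + 2})]
  · rw [Finset.sum_pair (by simp)]
    simp [gradMinus]; ring
  · intro k hk
    simp only [Finset.mem_insert, Finset.mem_singleton, not_or] at hk
    rcases k with _ | k
    · simp [gradMinus]
    · have h1 : k ≠ n := by rintro rfl; simp at hk
      have h2 : k ≠ n + 1 := by rintro rfl; simp at hk
      simp [gradMinus, h1, h2]

namespace IsNonlinearMM1Solution

variable {ν : ℝ} {h : ℝ → ℝ} {Γ : ℝ → ℕ → ℝ}

theorem hasDerivWithinAt_zero (hΓ : IsNonlinearMM1Solution ν h Γ) {t : ℝ} (ht : 0 ≤ t) :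
    HasDerivWithinAt (fun s => Γ s 0) (-(Γ t 0 - ν * h (Γ t 0) * Γ t 1)) (Set.Ici 0) t := by
  have := hΓ.hasDeriv (Pi.single 0 1) (fun n => (Pi.single_nonneg.2 zero_le_one : (0 : ℕ → ℝ) ≤ Pi.single 0 1) n)
    ((Set.finite_singleton 0).subset Pi.support_single_subset) t ht
  simp only [pairing_single, pairing_gradPlus_single_zero, pairing_gradMinus_single_zero] at this
  convert this using 1; ring

theorem hasDerivWithinAt_succ (hΓ : IsNonlinearMM1Solution ν h Γ) {t : ℝ} (ht : 0 ≤ t) (n : ℕ) :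
    HasDerivWithinAt (fun s => Γ s (n + 1))
      ((Γ t n - ν * h (Γ t 0) * Γ t (n + 1)) - (Γ t (n + 1) - ν * h (Γ t 0) * Γ t (n + 2)))
      (Set.Ici 0) t := by
  have := hΓ.hasDeriv (Pi.single (n + 1) 1) (fun k => (Pi.single_nonneg.2 zero_le_one : (0 : ℕ → ℝ) ≤ Pi.single (n + 1) 1) k)
    ((Set.finite_singleton (n + 1)).subset Pi.support_single_subset) t ht
  simp only [pairing_single, pairing_gradPlus_single_succ, pairing_gradMinus_single_succ] at this
  convert this using 1; ring

theorem shift (hΓ : IsNonlinearMM1Solution ν h Γ) {a : ℝ} (ha : 0 ≤ a) :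
    IsNonlinearMM1Solution ν h (fun s => Γ (s + a)) where
  mem_probDist t ht := hΓ.mem_probDist _ (by positivity)
  hasDeriv f hf hs t ht := by
    have h1 := hΓ.hasDeriv f hf hs (t + a) (by positivity)
    have h2 : HasDerivWithinAt (fun s : ℝ => s + a) 1 (Set.Ici 0) t :=
      ((hasDerivAt_id t).add_const a).hasDerivWithinAt
    have := h1.comp t h2 (fun s hs => Set.mem_Ici.2 (add_nonneg hs ha))
    rwa [mul_one] at this

theorem nonneg (hΓ : IsNonlinearMM1Solution ν h Γ) {t : ℝ} (ht : 0 ≤ t) (n : ℕ) : 0 ≤ Γ t n :=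
  (hΓ.mem_probDist t ht).1 n

theorem le_one (hΓ : IsNonlinearMM1Solution ν h Γ) {t : ℝ} (ht : 0 ≤ t) (n : ℕ) : Γ t n ≤ 1 :=
  le_hasSum (hΓ.mem_probDist t ht).2 n fun k _ => hΓ.nonneg ht k

open Finset in
/-- Derivative of a finitely supported weighted energy of the deviation from a geometric law. -/
theorem hasDerivWithinAt_weightedEnergy (hΓ : IsNonlinearMM1Solution ν h Γ) (ρ : ℝ) (w : ℕ → ℝ)
    (N : ℕ) {t : ℝ} (ht : 0 ≤ t) (u J : ℕ → ℝ) (hu : ∀ n, u n = Γ t n - (1 - ρ) * ρ ^ n)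
    (hJ : ∀ n, J n = u n - ν * h (Γ t 0) * u (n + 1)
      + (1 - ν * h (Γ t 0) * ρ) * ((1 - ρ) * ρ ^ n)) :
    HasDerivWithinAt (fun s => ∑ n ∈ range (N + 1), w n * (Γ s n - (1 - ρ) * ρ ^ n) ^ 2)
      (2 * (∑ n ∈ range N, (w (n + 1) * u (n + 1) - w n * u n) * J n - w N * u N * J N))
      (Set.Ici 0) t := by
  have hJ' : ∀ n, J n = Γ t n - ν * h (Γ t 0) * Γ t (n + 1) := by
    intro n; rw [hJ, hu, hu]; ring
  let D : ℕ → ℝ := fun n => Nat.casesOn n (-J 0) (fun n => J n - J (n + 1))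
  have hD : ∀ n, HasDerivWithinAt (fun s => Γ s n) (D n) (Set.Ici 0) t := by
    rintro (_ | n)
    · exact (hΓ.hasDerivWithinAt_zero ht).congr_deriv (by rw [← hJ' 0]; rfl)
    · exact (hΓ.hasDerivWithinAt_succ ht n).congr_deriv (by rw [← hJ' n, ← hJ' (n + 1)])
  rw [← sum_mul_flux_sub (fun n => w n * u n) J D rfl (fun n => rfl), mul_sum]
  apply HasDerivWithinAt.fun_sum
  intro n _
  refine ((((hD n).sub_const ((1 - ρ) * ρ ^ n)).pow 2).const_mul (w n)).congr_deriv ?_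
  rw [hu]; push_cast; ring

end IsNonlinearMM1Solution

/-! ### Crude growth bound for truncated energies -/

open Finset in
/-- Rate of growth of an energy whose weights vary at most geometrically. -/
theorem weightedEnergy_growth {ρ M L m : ℝ} (hρ0 : 0 < ρ) (hρ1 : ρ < 1) (hM : 0 ≤ M) (hL : 0 ≤ L)
    (hm0 : 0 ≤ m) (hmM : m ≤ M) (u w : ℕ → ℝ) (hu : ∀ n, |u n| ≤ 1)
    (hmL : |1 - m * ρ| ≤ L * |u 0|) (hw : ∀ n, 0 ≤ w n) (hw0 : w 0 = 1)
    (hwρ : ∀ n, w n * ρ ^ n ≤ 1) (hw1 : ∀ n, w (n + 1) ≤ ρ⁻¹ * w n)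
    (hw2 : ∀ n, w n ≤ ρ⁻¹ * w (n + 1)) (N : ℕ) (J : ℕ → ℝ)
    (hJ : ∀ n, J n = u n - m * u (n + 1) + (1 - m * ρ) * ((1 - ρ) * ρ ^ n)) :
    ∑ n ∈ range N, (w (n + 1) * u (n + 1) - w n * u n) * J n - w N * u N * J N ≤
      ρ⁻¹ * (1 + M + L) * (2 + (1 - ρ)⁻¹) * ∑ n ∈ range (N + 1), w n * u n ^ 2
        + w N * (1 + M + L) := by
  set A := ρ⁻¹ with hA
  have hA1 : 1 ≤ A := (one_le_inv₀ hρ0).2 hρ1.le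
  have hAρ : A * ρ = 1 := inv_mul_cancel₀ hρ0.ne'
  set E := ∑ n ∈ range (N + 1), w n * u n ^ 2 with hE
  set G := A * (1 + M + L) with hG
  have hG0 : 0 ≤ G := by positivity
  have hT : ∀ n, 0 ≤ w n * u n ^ 2 := fun n => mul_nonneg (hw n) (sq_nonneg _)
  have hρn : ∀ n, 0 < ρ ^ n := fun n => pow_pos hρ0 n
  have hρn1 : ∀ n, ρ ^ n ≤ 1 := fun n => pow_le_one₀ hρ0.le hρ1.le
  -- The change of service rate forces every site through `u 0`; `w n * ρ ^ n ≤ 1` leaves a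
  -- remainder that is summable in `n`.
  have hforce : ∀ n, |u 0| * (w n * |u n| * ρ ^ n) ≤ 1 / 2 * (w n * u n ^ 2 + ρ ^ n * u 0 ^ 2) := by
    intro n
    have h1 := mul_nonneg (hw n) (sq_nonneg (|u n| - ρ ^ n * |u 0|))
    have h2 : w n * (ρ ^ n) ^ 2 * u 0 ^ 2 ≤ ρ ^ n * u 0 ^ 2 := by
      apply mul_le_mul_of_nonneg_right _ (sq_nonneg _)
      nlinarith [hwρ n, hρn n]
    rw [← sq_abs (u n)]
    rw [← sq_abs (u 0)] at h2 ⊢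
    nlinarith
  have hu0E : u 0 ^ 2 ≤ E := by
    have := single_le_sum (f := fun n => w n * u n ^ 2) (fun n _ => hT n)
      (mem_range.2 (Nat.succ_pos N))
    simpa [hw0] using this
  have hterm : ∀ n, (w (n + 1) * u (n + 1) - w n * u n) * J n ≤
      G * (w n * u n ^ 2 + w (n + 1) * u (n + 1) ^ 2 + ρ ^ n * u 0 ^ 2) := by
    intro n
    have e1 : w (n + 1) * u (n + 1) * u n ≤
        1 / 2 * (w (n + 1) * u (n + 1) ^ 2 + A * (w n * u n ^ 2)) := by
      nlinarith [mul_nonneg (hw (n + 1)) (sq_nonneg (u (n + 1) - u n)),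
        mul_le_mul_of_nonneg_right (hw1 n) (sq_nonneg (u n))]
    have e2 : m * (w n * u n * u (n + 1)) ≤
        M * (1 / 2 * (w n * u n ^ 2 + A * (w (n + 1) * u (n + 1) ^ 2))) := by
      have : w n * u n * u (n + 1) ≤
          1 / 2 * (w n * u n ^ 2 + A * (w (n + 1) * u (n + 1) ^ 2)) := by
        nlinarith [mul_nonneg (hw n) (sq_nonneg (u (n + 1) - u n)),
          mul_le_mul_of_nonneg_right (hw2 n) (sq_nonneg (u (n + 1)))]
      refine (mul_le_mul_of_nonneg_left this hm0).trans (mul_le_mul_of_nonneg_right hmM ?_)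
      have := hT n
      have := hT (n + 1)
      positivity
    have e3 : (w (n + 1) * u (n + 1) - w n * u n) * ((1 - m * ρ) * ((1 - ρ) * ρ ^ n)) ≤
        L * (A * (1 / 2 * (w (n + 1) * u (n + 1) ^ 2 + ρ ^ (n + 1) * u 0 ^ 2)) +
          1 / 2 * (w n * u n ^ 2 + ρ ^ n * u 0 ^ 2)) := by
      have a1 : |w (n + 1) * u (n + 1) - w n * u n| ≤ w (n + 1) * |u (n + 1)| + w n * |u n| := by
        refine (abs_sub _ _).trans_eq ?_
        rw [abs_mul, abs_mul, abs_of_nonneg (hw n), abs_of_nonneg (hw (n + 1))]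
      have a2 : |(1 - m * ρ) * ((1 - ρ) * ρ ^ n)| ≤ L * |u 0| * ρ ^ n := by
        rw [abs_mul, abs_of_nonneg (mul_nonneg (by linarith) (hρn n).le : 0 ≤ (1 - ρ) * ρ ^ n)]
        exact mul_le_mul hmL (by nlinarith [hρn n]) (mul_nonneg (by linarith) (hρn n).le)
          (by positivity)
      refine (le_abs_self _).trans ?_
      rw [abs_mul]
      have b0 : 0 ≤ w (n + 1) * |u (n + 1)| + w n * |u n| :=
        add_nonneg (mul_nonneg (hw _) (abs_nonneg _)) (mul_nonneg (hw _) (abs_nonneg _))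
      refine (mul_le_mul a1 a2 (abs_nonneg _) b0).trans ?_
      have : (w (n + 1) * |u (n + 1)| + w n * |u n|) * (L * |u 0| * ρ ^ n) =
          L * (A * (|u 0| * (w (n + 1) * |u (n + 1)| * ρ ^ (n + 1))) +
            |u 0| * (w n * |u n| * ρ ^ n)) := by
        rw [pow_succ]
        linear_combination (-L * w (n + 1) * |u (n + 1)| * |u 0| * ρ ^ n) * hAρ
      rw [this]
      exact mul_le_mul_of_nonneg_left (add_le_add (mul_le_mul_of_nonneg_left (hforce _)
        (by positivity)) (hforce _)) hL
    rw [hJ]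
    have e4 : A * ρ ^ (n + 1) = ρ ^ n := by rw [pow_succ]; linear_combination ρ ^ n * hAρ
    have t0 := hT n
    have t1 := hT (n + 1)
    have t2 : 0 ≤ ρ ^ n * u 0 ^ 2 := mul_nonneg (hρn n).le (sq_nonneg _)
    have t3 : 0 ≤ m * (w (n + 1) * u (n + 1) ^ 2) := mul_nonneg hm0 t1
    have e3' : L * (A * (1 / 2 * (w (n + 1) * u (n + 1) ^ 2 + ρ ^ (n + 1) * u 0 ^ 2)) +
          1 / 2 * (w n * u n ^ 2 + ρ ^ n * u 0 ^ 2)) =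
        L * (A * (1 / 2 * (w (n + 1) * u (n + 1) ^ 2)) + 1 / 2 * (w n * u n ^ 2)
          + ρ ^ n * u 0 ^ 2) := by
      linear_combination (L / 2 * u 0 ^ 2) * e4
    rw [e3'] at e3
    generalize w n * u n ^ 2 = T at *
    have key : (w (n + 1) * u (n + 1) - w n * u n) *
        (u n - m * u (n + 1) + (1 - m * ρ) * ((1 - ρ) * ρ ^ n)) =
        w (n + 1) * u (n + 1) * u n - w n * u n ^ 2 - m * (w (n + 1) * u (n + 1) ^ 2)
        + m * (w n * u n * u (n + 1)) +
        (w (n + 1) * u (n + 1) - w n * u n) * ((1 - m * ρ) * ((1 - ρ) * ρ ^ n)) := by ring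
    rw [key]
    have t0' := hT n
    generalize w (n + 1) * u (n + 1) ^ 2 = T' at *
    generalize ρ ^ n * u 0 ^ 2 = R at *
    have hAM : M ≤ A * M := le_mul_of_one_le_left hM hA1
    have hAL : L ≤ A * L := le_mul_of_one_le_left hL hA1
    have q1 := mul_nonneg hM t0
    have q2 := mul_nonneg hL t0
    have q3 := mul_nonneg (sub_nonneg.2 hAM) t0
    have q4 := mul_nonneg (sub_nonneg.2 hAL) t0
    have q5 := mul_nonneg (sub_nonneg.2 hA1) t0
    have q6 := mul_nonneg (sub_nonneg.2 hA1) t1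
    have q7 := mul_nonneg (sub_nonneg.2 hAM) t1
    have q8 := mul_nonneg (sub_nonneg.2 hAL) t1
    have q9 := mul_nonneg (sub_nonneg.2 hAL) t2
    have q10 := mul_nonneg hM t1
    have q11 := mul_nonneg hL t1
    have q12 := mul_nonneg (sub_nonneg.2 hA1) t2
    have q13 := mul_nonneg (sub_nonneg.2 hAM) t2
    have q14 := mul_nonneg hM t2
    rw [hG]
    nlinarith
  have hgeom : ∑ n ∈ range N, ρ ^ n ≤ (1 - ρ)⁻¹ := by
    rw [← tsum_geometric_of_lt_one hρ0.le hρ1]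
    exact (summable_geometric_of_lt_one hρ0.le hρ1).sum_le_tsum _ (fun n _ => (hρn n).le)
  have hsum1 : ∑ n ∈ range N, w n * u n ^ 2 ≤ E :=
    sum_le_sum_of_subset_of_nonneg (range_mono (Nat.le_succ N)) (fun n _ _ => hT n)
  have hsum2 : ∑ n ∈ range N, w (n + 1) * u (n + 1) ^ 2 ≤ E := by
    rw [hE, sum_range_succ' _ N]; linarith [hT 0]
  have hmain : ∑ n ∈ range N, (w (n + 1) * u (n + 1) - w n * u n) * J n ≤
      G * (2 + (1 - ρ)⁻¹) * E := by
    refine (sum_le_sum fun n _ => hterm n).trans ?_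
    rw [← mul_sum, sum_add_distrib, sum_add_distrib, ← sum_mul, mul_assoc G]
    apply mul_le_mul_of_nonneg_left _ hG0
    have : (∑ n ∈ range N, ρ ^ n) * u 0 ^ 2 ≤ (1 - ρ)⁻¹ * E :=
      mul_le_mul hgeom hu0E (sq_nonneg _) (inv_nonneg.2 (by linarith))
    linarith
  -- The boundary flux involves `u (N + 1)`, outside the energy, so only `|u| ≤ 1` is used; the
  -- factor `w N` will tend to zero.
  have hbd : -(w N * u N * J N) ≤ w N * (1 + M + L) := by
    have hJb : |J N| ≤ 1 + M + L := by
      rw [hJ]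
      have a1 : |m * u (N + 1)| ≤ M := by
        rw [abs_mul, abs_of_nonneg hm0]
        nlinarith [hu (N + 1), abs_nonneg (u (N + 1))]
      have a2 : |(1 - m * ρ) * ((1 - ρ) * ρ ^ N)| ≤ L := by
        have p0 : 0 ≤ (1 - ρ) * ρ ^ N := mul_nonneg (by linarith) (hρn N).le
        have p1 : (1 - ρ) * ρ ^ N ≤ 1 := mul_le_one₀ (by linarith) (hρn N).le (hρn1 N)
        rw [abs_mul, abs_of_nonneg p0]
        have := mul_le_mul_of_nonneg_left (hu 0) hL
        calc _ ≤ L * |u 0| * 1 := mul_le_mul hmL p1 p0 (by positivity)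
          _ ≤ L := by linarith
      have := hu N
      rw [abs_le] at *
      constructor <;> linarith [this.1, this.2, a1.1, a1.2, a2.1, a2.2]
    refine (neg_le_abs _).trans ?_
    rw [mul_assoc, abs_mul, abs_mul, abs_of_nonneg (hw N)]
    apply mul_le_mul_of_nonneg_left _ (hw N)
    nlinarith [hu N, abs_nonneg (u N), abs_nonneg (J N)]
  linarith

/-! ### Hardy inequality and sharp dissipation under a linear cutoff -/

open Finset in
theorem sum_range_shift {φ : ℕ → ℝ} {N : ℕ} (hφ : φ N = 0) :
    ∑ n ∈ range N, φ (n + 1) = ∑ n ∈ range N, φ n - φ 0 := by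
  have h1 := sum_range_succ φ N
  have h2 := sum_range_succ' φ N
  linarith

open Finset in
/-- A discrete Hardy inequality with geometric weights, for sequences vanishing at `0`. -/
theorem geometric_hardy {ρ r : ℝ} (hr : 1 < r) (hρ : ρ * r ^ 2 = 1) {χ G : ℕ → ℝ} {N : ℕ}
    (hχ : ∀ n, χ (n + 1) ≤ χ n) (hχ0 : ∀ n < N, 0 ≤ χ n) (hχN : χ N = 0) (hG : G 0 = 0) :
    (r - 1) ^ 2 * ∑ n ∈ range N, χ n * (ρ ^ n * G n ^ 2) ≤
      ∑ n ∈ range N, χ n * (ρ ^ n * (G (n + 1) - G n) ^ 2) := by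
  have hr0 : 0 < r := by linarith
  have hρ0 : 0 < ρ := pos_of_mul_pos_left (hρ ▸ one_pos) (by positivity)
  have hρn : ∀ n, 0 < ρ ^ n := fun n => pow_pos hρ0 n
  have hshift : ∑ n ∈ range N, χ (n + 1) * (ρ ^ (n + 1) * G (n + 1) ^ 2) =
      ∑ n ∈ range N, χ n * (ρ ^ n * G n ^ 2) := by
    rw [sum_range_shift (φ := fun n => χ n * (ρ ^ n * G n ^ 2)) (by simp [hχN])]
    simp [hG]
  have key : ∀ n ∈ range N, r * (r - 1) * (χ (n + 1) * (ρ ^ (n + 1) * G (n + 1) ^ 2)) -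
      (r - 1) * (χ n * (ρ ^ n * G n ^ 2)) ≤ χ n * (ρ ^ n * (G (n + 1) - G n) ^ 2) := by
    intro n hn
    have h1 : r * (r - 1) * (χ (n + 1) * (ρ ^ (n + 1) * G (n + 1) ^ 2)) ≤
        r * (r - 1) * (χ n * (ρ ^ (n + 1) * G (n + 1) ^ 2)) :=
      mul_le_mul_of_nonneg_left (mul_le_mul_of_nonneg_right (hχ n)
        (mul_nonneg (hρn _).le (sq_nonneg _))) (mul_nonneg hr0.le (by linarith))
    have h2 : χ n * (ρ ^ n * (G (n + 1) - G n) ^ 2) -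
        (r * (r - 1) * (χ n * (ρ ^ (n + 1) * G (n + 1) ^ 2)) - (r - 1) * (χ n * (ρ ^ n * G n ^ 2)))
        -- A completed square, vanishing along `G (n + 1) = r * G n`. After summation the shifted
        -- sums agree, and `r(r-1) - (r-1) = (r-1)²`.
        = r * (χ n * ρ ^ n) * (r * ρ * G (n + 1) - G n) ^ 2 := by
      rw [pow_succ]
      linear_combination (-(χ n * ρ ^ n * G (n + 1) ^ 2) * (1 + r * ρ)
        + 2 * χ n * ρ ^ n * G (n + 1) * G n) * hρ
    have h3 : 0 ≤ r * (χ n * ρ ^ n) * (r * ρ * G (n + 1) - G n) ^ 2 :=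
      mul_nonneg (mul_nonneg hr0.le (mul_nonneg (hχ0 n (mem_range.1 hn)) (hρn n).le)) (sq_nonneg _)
    linarith
  refine le_trans (le_of_eq ?_) (sum_le_sum key)
  rw [sum_sub_distrib, ← mul_sum, ← mul_sum, hshift]
  ring

-- As the total sum vanishes, the cut off sum is minus the sum of `min(n/N, 1) uₙ`, and `min(n/N, 1)
-- ≤ n/N` brings in the first moment.
open Finset in
theorem abs_sum_linear_cutoff_le {u : ℕ → ℝ} {B : ℝ} {N : ℕ} (hN : 0 < N) (hu : HasSum u 0)
    (hB : ∀ k, ∑ n ∈ range k, n * |u n| ≤ B) :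
    |∑ n ∈ range N, (1 - (n : ℝ) / N) * u n| ≤ B / N := by
  have hN' : (0 : ℝ) < N := by exact_mod_cast hN
  have hlim : Filter.Tendsto
      (fun k => |∑ n ∈ range N, (1 - (n : ℝ) / N) * u n - ∑ n ∈ range k, u n|) Filter.atTop
      (nhds |∑ n ∈ range N, (1 - (n : ℝ) / N) * u n - 0|) :=
    (hu.tendsto_sum_nat.const_sub _).abs
  rw [sub_zero] at hlim
  refine le_of_tendsto hlim (Filter.eventually_atTop.2 ⟨N, fun k hk => ?_⟩)
  have h1 : ∑ n ∈ range N, (1 - (n : ℝ) / N) * u n - ∑ n ∈ range k, u n =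
      -∑ n ∈ range k, (if n < N then (n : ℝ) / N else 1) * u n := by
    rw [← sum_range_add_sum_Ico (fun n => (if n < N then (n : ℝ) / N else 1) * u n) hk,
      ← sum_range_add_sum_Ico u hk]
    have a1 : ∑ n ∈ range N, (if n < N then (n : ℝ) / N else 1) * u n =
        ∑ n ∈ range N, (n : ℝ) / N * u n :=
      sum_congr rfl fun n hn => by rw [if_pos (mem_range.1 hn)]
    have a2 : ∑ n ∈ Ico N k, (if n < N then (n : ℝ) / N else 1) * u n = ∑ n ∈ Ico N k, u n :=
      sum_congr rfl fun n hn => by rw [if_neg (not_lt.2 (mem_Ico.1 hn).1), one_mul]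
    rw [a1, a2]
    simp only [sub_mul, one_mul, sum_sub_distrib]
    ring
  rw [h1, abs_neg, le_div_iff₀ hN']
  refine le_trans ?_ (hB k)
  refine (mul_le_mul_of_nonneg_right (abs_sum_le_sum_abs _ _) hN'.le).trans ?_
  rw [sum_mul]
  refine sum_le_sum fun n _ => ?_
  rw [abs_mul]
  split_ifs with hn
  · rw [abs_of_nonneg (by positivity)]
    apply le_of_eq; field_simp
  · have : (N : ℝ) ≤ n := by exact_mod_cast not_lt.1 hn
    rw [abs_one, one_mul, mul_comm]
    exact mul_le_mul_of_nonneg_right this (abs_nonneg _)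

set_option maxHeartbeats 1000000 in
open Finset in
/-- Dissipation of the linearly cut off energy, up to an error of the order of the slope. -/
theorem cutoffEnergy_dissipation {ρ r β κ Q c : ℝ} (hr : 1 < r) (hρ : ρ * r ^ 2 = 1) (hβ : 0 ≤ β)
    (hκ : 0 ≤ κ) (hQ : ∀ k, ∑ n ∈ range k, (n : ℝ) ^ 2 * ρ ^ n ≤ Q) {x : ℕ → ℝ}
    (hx : ∀ k, ∑ n ∈ range k, ρ ^ n * x n ^ 2 ≤ κ ^ 2) (hsum : HasSum (fun n => ρ ^ n * x n) 0)
    (hc : |c| ≤ β * |x 0|) {N : ℕ} (hN : 0 < N) {χ : ℕ → ℝ} (hχ : ∀ n, χ n = 1 - (n : ℝ) / N) :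
    ∑ n ∈ range N, (χ (n + 1) * x (n + 1) - χ n * x n) *
        (ρ ^ n * (x n - x (n + 1) + c * x (n + 1) + c * (1 - ρ))) ≤
      -((r - 1) ^ 2 - β * r ^ 2 * (1 - ρ) - 2 * r ^ 2 * (β * κ)) *
          ∑ n ∈ range N, χ n * (ρ ^ n * x n ^ 2) +
        (2 * r ^ 2 * κ ^ 2 + β * κ * r ^ 2 * κ ^ 2 +
          (2 * (r - 1) ^ 2 + β * r ^ 2) * κ * ((κ ^ 2 + Q) / 2)) / N := by
  have hN' : (0 : ℝ) < N := by exact_mod_cast hN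
  have hr0 : 0 < r := by linarith
  have hρ0 : 0 < ρ := pos_of_mul_pos_left (hρ ▸ one_pos) (by positivity)
  have hr2 : 1 ≤ r ^ 2 := by nlinarith
  have hρ1 : ρ ≤ 1 := by nlinarith
  have hρn : ∀ n, 0 < ρ ^ n := fun n => pow_pos hρ0 n
  set δ : ℝ := 1 / N with hδ
  have hδ0 : 0 < δ := by positivity
  set B := (κ ^ 2 + Q) / 2 with hB
  have hχs : ∀ n, χ (n + 1) = χ n - δ := by
    intro n; rw [hχ, hχ, hδ]; push_cast; ring
  have hχ0 : χ 0 = 1 := by simp [hχ]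
  have hχN : χ N = 0 := by rw [hχ, div_self hN'.ne', sub_self]
  have hχnn : ∀ n ≤ N, 0 ≤ χ n := by
    intro n hn
    rw [hχ, sub_nonneg, div_le_one hN']
    exact_mod_cast hn
  set E := ∑ n ∈ range N, χ n * (ρ ^ n * x n ^ 2) with hE
  have hTn : ∀ n, 0 ≤ ρ ^ n * x n ^ 2 := fun n => mul_nonneg (hρn n).le (sq_nonneg _)
  have hTχ : ∀ n ≤ N, 0 ≤ χ n * (ρ ^ n * x n ^ 2) := fun n hn => mul_nonneg (hχnn n hn) (hTn n)
  have hx0E : x 0 ^ 2 ≤ E := by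
    have := single_le_sum (f := fun n => χ n * (ρ ^ n * x n ^ 2))
      (fun n hn => hTχ n (mem_range.1 hn).le) (mem_range.2 hN)
    simpa [hχ0] using this
  have hx0κ : |x 0| ≤ κ := by
    apply abs_le_of_sq_le_sq _ hκ
    simpa using hx 1
  set s := ∑ n ∈ range N, χ n * (ρ ^ n * x n) with hs
  -- The first moment is controlled by the energy and `∑ n² ρⁿ`, so the cut off mean is `O(1/N)`.
  have hsB : |s| ≤ B * δ := by
    have h1 : ∀ k, ∑ n ∈ range k, (n : ℝ) * |ρ ^ n * x n| ≤ B := by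
      intro k
      have h2 : ∀ n ∈ range k, (n : ℝ) * |ρ ^ n * x n| ≤
          1 / 2 * (ρ ^ n * x n ^ 2) + 1 / 2 * ((n : ℝ) ^ 2 * ρ ^ n) := by
        intro n _
        rw [abs_mul, abs_of_pos (hρn n), ← sq_abs (x n)]
        nlinarith [mul_nonneg (hρn n).le (sq_nonneg (|x n| - n))]
      refine (sum_le_sum h2).trans ?_
      rw [sum_add_distrib, ← mul_sum, ← mul_sum, hB]
      linarith [hx k, hQ k]
    have := abs_sum_linear_cutoff_le hN hsum h1
    simp only [← hχ] at this
    rw [hδ, mul_one_div]; exact this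
  have hκs : |x 0| * |s| ≤ κ * (B * δ) := mul_le_mul hx0κ hsB (abs_nonneg _) hκ
  have hx1 : ∀ k, ∑ n ∈ range k, ρ ^ (n + 1) * x (n + 1) ^ 2 ≤ κ ^ 2 := by
    intro k
    have := hx (k + 1)
    rw [sum_range_succ'] at this
    linarith [hTn 0]
  have hE1 : ∑ n ∈ range N, χ (n + 1) * (ρ ^ (n + 1) * x (n + 1) ^ 2) ≤ E := by
    rw [sum_range_shift (φ := fun n => χ n * (ρ ^ n * x n ^ 2)) (by simp [hχN])]
    linarith [hTχ 0 hN.le]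
  have hρr : ∀ n, ρ ^ n = r ^ 2 * ρ ^ (n + 1) := by
    intro n; rw [pow_succ]; linear_combination (-ρ ^ n) * hρ
  -- the dissipation term
  have hI : (r - 1) ^ 2 * (E - 2 * (κ * (B * δ))) ≤
      ∑ n ∈ range N, χ n * (ρ ^ n * (x (n + 1) - x n) ^ 2) := by
    -- Hardy needs a sequence vanishing at `0`. Subtracting `x 0` costs only `2 * x 0 * s`, as the
    -- other new term is nonnegative.
    have h1 := geometric_hardy (G := fun n => x n - x 0) hr hρ (N := N) (χ := χ)
      (fun n => by rw [hχs]; linarith) (fun n hn => hχnn n hn.le) hχN (sub_self _)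
    simp only [sub_sub_sub_cancel_right] at h1
    refine le_trans (mul_le_mul_of_nonneg_left ?_ (sq_nonneg _)) h1
    have h2 : ∑ n ∈ range N, χ n * (ρ ^ n * (x n - x 0) ^ 2) =
        E - 2 * (x 0 * s) + x 0 ^ 2 * ∑ n ∈ range N, χ n * ρ ^ n := by
      rw [hE, hs, mul_sum, mul_sum, mul_sum, ← sum_sub_distrib, ← sum_add_distrib]
      exact sum_congr rfl fun n _ => by ring
    have h3 : 0 ≤ x 0 ^ 2 * ∑ n ∈ range N, χ n * ρ ^ n :=
      mul_nonneg (sq_nonneg _) (sum_nonneg fun n hn =>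
        mul_nonneg (hχnn n (mem_range.1 hn).le) (hρn n).le)
    have h4 : x 0 * s ≤ κ * (B * δ) := by
      refine (le_abs_self _).trans ?_
      rw [abs_mul]; exact hκs
    linarith
  -- the error from the slope of the cutoff
  have hII : ∑ n ∈ range N, ρ ^ n * (x (n + 1) * (x (n + 1) - x n)) ≤ 2 * r ^ 2 * κ ^ 2 := by
    have h1 : ∀ n ∈ range N, ρ ^ n * (x (n + 1) * (x (n + 1) - x n)) ≤
        3 / 2 * r ^ 2 * (ρ ^ (n + 1) * x (n + 1) ^ 2) + 1 / 2 * (ρ ^ n * x n ^ 2) := by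
      intro n _
      have h2 : r ^ 2 * (ρ ^ (n + 1) * x (n + 1) ^ 2) = ρ ^ n * x (n + 1) ^ 2 := by
        rw [hρr n]; ring
      nlinarith [mul_nonneg (hρn n).le (sq_nonneg (x (n + 1) + x n))]
    refine (sum_le_sum h1).trans ?_
    rw [sum_add_distrib, ← mul_sum, ← mul_sum]
    nlinarith [hx1 N, hx N, sq_nonneg κ]
  -- the quadratic part of the perturbation
  have hIII : |∑ n ∈ range N, ρ ^ n * (x (n + 1) * (χ (n + 1) * x (n + 1) - χ n * x n))| ≤
      2 * r ^ 2 * E + r ^ 2 * (δ * κ ^ 2) := by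
    have h1 : ∀ n ∈ range N, |ρ ^ n * (x (n + 1) * (χ (n + 1) * x (n + 1) - χ n * x n))| ≤
        3 / 2 * r ^ 2 * (χ (n + 1) * (ρ ^ (n + 1) * x (n + 1) ^ 2)) +
          (1 / 2 * (χ n * (ρ ^ n * x n ^ 2)) +
          1 / 2 * r ^ 2 * (δ * (ρ ^ (n + 1) * x (n + 1) ^ 2))) := by
      intro n hn
      have hn' := mem_range.1 hn
      have h2 : ρ ^ n * x (n + 1) ^ 2 = r ^ 2 * (ρ ^ (n + 1) * x (n + 1) ^ 2) := by
        rw [hρr n]; ring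
      have c0 := hχnn n hn'.le
      have c1 := hχnn (n + 1) hn'
      have h3 : χ n = χ (n + 1) + δ := by rw [hχs]; ring
      have h4 := mul_nonneg (mul_nonneg c0 (hρn n).le) (sq_nonneg (x (n + 1) + x n))
      have h5 := mul_nonneg (mul_nonneg c0 (hρn n).le) (sq_nonneg (x (n + 1) - x n))
      have h6 : χ n * (ρ ^ n * x (n + 1) ^ 2) =
          r ^ 2 * (χ (n + 1) * (ρ ^ (n + 1) * x (n + 1) ^ 2)) +
            r ^ 2 * (δ * (ρ ^ (n + 1) * x (n + 1) ^ 2)) := by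
        rw [h2, h3]; ring
      have h7 : χ (n + 1) * (ρ ^ n * x (n + 1) ^ 2) =
          r ^ 2 * (χ (n + 1) * (ρ ^ (n + 1) * x (n + 1) ^ 2)) := by
        rw [h2]; ring
      have h8 : 0 ≤ χ (n + 1) * (ρ ^ n * x (n + 1) ^ 2) :=
        mul_nonneg c1 (mul_nonneg (hρn n).le (sq_nonneg _))
      have h9 : ρ ^ n * (x (n + 1) * (χ (n + 1) * x (n + 1) - χ n * x n)) =
          χ (n + 1) * (ρ ^ n * x (n + 1) ^ 2) - χ n * ρ ^ n * (x (n + 1) * x n) := by ring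
      have h4' : -(χ n * ρ ^ n * (x (n + 1) * x n)) ≤
          1 / 2 * (χ n * (ρ ^ n * x n ^ 2)) + 1 / 2 * (χ n * (ρ ^ n * x (n + 1) ^ 2)) := by
        linarith
      have h5' : χ n * ρ ^ n * (x (n + 1) * x n) ≤
          1 / 2 * (χ n * (ρ ^ n * x n ^ 2)) + 1 / 2 * (χ n * (ρ ^ n * x (n + 1) ^ 2)) := by
        linarith
      rw [h7] at h8 h9
      rw [h6] at h4' h5'
      rw [h9, abs_le]
      constructor <;> linarith
    refine (abs_sum_le_sum_abs _ _).trans ((sum_le_sum h1).trans ?_)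
    rw [sum_add_distrib, sum_add_distrib, ← mul_sum, ← mul_sum, ← mul_sum, ← mul_sum]
    have h2 := mul_le_mul_of_nonneg_left (hx1 N) hδ0.le
    have h3 : 0 ≤ δ * κ ^ 2 := by positivity
    nlinarith
  -- the linear part of the perturbation
  have hIV : ∑ n ∈ range N, ρ ^ n * (χ (n + 1) * x (n + 1) - χ n * x n) =
      (r ^ 2 - 1) * s - r ^ 2 * x 0 := by
    have h1 : ∑ n ∈ range N, χ (n + 1) * (ρ ^ (n + 1) * x (n + 1)) = s - x 0 := by
      rw [sum_range_shift (φ := fun n => χ n * (ρ ^ n * x n)) (by simp [hχN])]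
      simp [hs, hχ0]
    have h2 : ∑ n ∈ range N, ρ ^ n * (χ (n + 1) * x (n + 1) - χ n * x n) =
        r ^ 2 * (s - x 0) - s := by
      rw [← h1, hs, mul_sum, ← sum_sub_distrib]
      refine sum_congr rfl fun n _ => ?_
      linear_combination (χ (n + 1) * x (n + 1)) * hρr n
    rw [h2]; ring
  have hsplit : ∑ n ∈ range N, (χ (n + 1) * x (n + 1) - χ n * x n) *
        (ρ ^ n * (x n - x (n + 1) + c * x (n + 1) + c * (1 - ρ))) =
      -∑ n ∈ range N, χ n * (ρ ^ n * (x (n + 1) - x n) ^ 2)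
      + δ * ∑ n ∈ range N, ρ ^ n * (x (n + 1) * (x (n + 1) - x n))
      + c * ∑ n ∈ range N, ρ ^ n * (x (n + 1) * (χ (n + 1) * x (n + 1) - χ n * x n))
      + c * (1 - ρ) * ∑ n ∈ range N, ρ ^ n * (χ (n + 1) * x (n + 1) - χ n * x n) := by
    rw [← sum_neg_distrib, mul_sum, mul_sum, mul_sum, ← sum_add_distrib, ← sum_add_distrib,
      ← sum_add_distrib]
    refine sum_congr rfl fun n _ => ?_
    rw [hχs]; ring
  have hcκ : |c| ≤ β * κ := hc.trans (mul_le_mul_of_nonneg_left hx0κ hβ)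
  have hIII' : c * ∑ n ∈ range N, ρ ^ n * (x (n + 1) * (χ (n + 1) * x (n + 1) - χ n * x n)) ≤
      β * κ * (2 * r ^ 2 * E + r ^ 2 * (δ * κ ^ 2)) := by
    refine (le_abs_self _).trans ?_
    rw [abs_mul]
    exact mul_le_mul hcκ hIII (abs_nonneg _) (by positivity)
  -- The one quadratic term that competes with Hardy: up to `O(1/N)` only `x 0` survives, and `c` is
  -- itself of order `x 0`.
  have hIV' : c * (1 - ρ) * ((r ^ 2 - 1) * s - r ^ 2 * x 0) ≤
      β * r ^ 2 * (κ * (B * δ)) + β * r ^ 2 * (1 - ρ) * E := by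
    have a1 : |(r ^ 2 - 1) * s - r ^ 2 * x 0| ≤ r ^ 2 * (|s| + |x 0|) := by
      refine (abs_sub _ _).trans ?_
      rw [abs_mul, abs_mul, abs_of_nonneg (by linarith : 0 ≤ r ^ 2 - 1),
        abs_of_pos (by positivity : 0 < r ^ 2)]
      nlinarith [abs_nonneg s]
    refine (le_abs_self _).trans ?_
    rw [abs_mul, abs_mul, abs_of_nonneg (by linarith : 0 ≤ 1 - ρ)]
    calc |c| * (1 - ρ) * |(r ^ 2 - 1) * s - r ^ 2 * x 0|
        ≤ β * |x 0| * (1 - ρ) * (r ^ 2 * (|s| + |x 0|)) :=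
          mul_le_mul (mul_le_mul_of_nonneg_right hc (by linarith)) a1 (abs_nonneg _)
            (mul_nonneg (by positivity) (by linarith))
      _ = β * r ^ 2 * ((1 - ρ) * (|x 0| * |s|)) + β * r ^ 2 * (1 - ρ) * x 0 ^ 2 := by
          rw [← sq_abs (x 0)]; ring
      _ ≤ _ := by
          have b0 : 0 ≤ β * r ^ 2 := by positivity
          have b1 : (1 - ρ) * (|x 0| * |s|) ≤ κ * (B * δ) := by
            refine le_trans ?_ hκs
            have : 0 ≤ |x 0| * |s| := by positivity
            nlinarith
          exact add_le_add (mul_le_mul_of_nonneg_left b1 b0)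
            (mul_le_mul_of_nonneg_left hx0E (mul_nonneg b0 (by linarith)))
  have hII' := mul_le_mul_of_nonneg_left hII hδ0.le
  rw [hsplit, hIV, div_eq_mul_one_div _ (N : ℝ), ← hδ]
  linarith

/-! ### Grönwall and removal of the truncation -/

theorem le_gronwallBound_of_hasDerivWithinAt_Ici {f f' : ℝ → ℝ} {δ c ε T : ℝ}
    (hf : ∀ t, 0 ≤ t → HasDerivWithinAt f (f' t) (Set.Ici 0) t) (h0 : f 0 ≤ δ)
    (hb : ∀ t ∈ Set.Ico 0 T, f' t ≤ c * f t + ε) :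
    ∀ t ∈ Set.Icc 0 T, f t ≤ gronwallBound δ c ε t := by
  intro t ht
  have := le_gronwallBound_of_liminf_deriv_right_le (f := f) (f' := f') (a := 0) (b := T)
    (fun s hs => (hf s hs.1).continuousWithinAt.mono Set.Icc_subset_Ici_self)
    (fun s hs r hr => ((hf s hs.1).mono (Set.Ici_subset_Ici.2 hs.1)).liminf_right_slope_le hr)
    h0 hb t ht
  rwa [sub_zero] at this

theorem tendsto_gronwallBound_of_tendsto_zero {δ c t : ℝ} {ε : ℕ → ℝ}
    (hε : Filter.Tendsto ε Filter.atTop (nhds 0)) :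
    Filter.Tendsto (fun N => gronwallBound δ c (ε N) t) Filter.atTop
      (nhds (δ * Real.exp (c * t))) := by
  rw [← gronwallBound_ε0]
  exact ((gronwallBound_continuous_ε δ c t).tendsto 0).comp hε

/-- Partial sums of the weighted square deviation of `μ` from the geometric law of ratio `ρ`,
multiplied by `1 - ρ`. -/
noncomputable def geomEnergy (ρ : ℝ) (μ : ℕ → ℝ) (k : ℕ) : ℝ :=
  ∑ n ∈ Finset.range k, (ρ ^ n)⁻¹ * (μ n - (1 - ρ) * ρ ^ n) ^ 2

theorem hasSum_geometric_law {ρ : ℝ} (hρ0 : 0 < ρ) (hρ1 : ρ < 1) :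
    HasSum (fun n => (1 - ρ) * ρ ^ n) 1 := by
  have := (hasSum_geometric_of_lt_one hρ0.le hρ1).mul_left (1 - ρ)
  rwa [mul_inv_cancel₀ (by linarith)] at this

namespace IsNonlinearMM1Solution

variable {ν : ℝ} {h : ℝ → ℝ} {Γ : ℝ → ℕ → ℝ}

-- Makes the energy finite at later times, which the sharp estimate presupposes; the constant in the
-- exponent is immaterial.
open Finset in
theorem geomEnergy_growth (hΓ : IsNonlinearMM1Solution ν h Γ) {ρ M L K : ℝ} (hρ0 : 0 < ρ)
    (hρ1 : ρ < 1) (hM : ∀ y ∈ Set.Icc (0 : ℝ) 1, 0 ≤ ν * h y ∧ ν * h y ≤ M) (hL : 0 ≤ L)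
    (hlip : ∀ y ∈ Set.Icc (0 : ℝ) 1, |1 - ν * h y * ρ| ≤ L * |y - (1 - ρ)|)
    (hK : ∀ k, geomEnergy ρ (Γ 0) k ≤ K) {t : ℝ} (ht : 0 ≤ t) (k : ℕ) :
    geomEnergy ρ (Γ t) k ≤
      K * Real.exp (2 * (ρ⁻¹ * (1 + M + L) * (2 + (1 - ρ)⁻¹)) * t) := by
  have hρn : ∀ n, 0 < ρ ^ n := fun n => pow_pos hρ0 n
  have hA1 : 1 ≤ ρ⁻¹ := (one_le_inv₀ hρ0).2 hρ1.le
  -- A tent on the logarithmic scale: the true weight up to `k`, then geometric decay. Ratios stay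
  -- within `ρ⁻¹`, and the weight at `N` tends to zero.
  let w : ℕ → ℝ := fun n => min (ρ ^ n)⁻¹ (ρ ^ n / (ρ ^ k) ^ 2)
  have hw : ∀ n, 0 ≤ w n := fun n => le_min (inv_nonneg.2 (hρn n).le) (by positivity)
  have hwle : ∀ n, w n ≤ (ρ ^ n)⁻¹ := fun n => min_le_left _ _
  have hwk : ∀ n ≤ k, w n = (ρ ^ n)⁻¹ := by
    intro n hn
    apply min_eq_left
    rw [inv_eq_one_div, div_le_div_iff₀ (hρn n) (by positivity)]
    have := pow_le_pow_of_le_one hρ0.le hρ1.le hn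
    nlinarith [hρn k]
  have hwlim : Filter.Tendsto w Filter.atTop (nhds 0) := by
    have h1 := (tendsto_pow_atTop_nhds_zero_of_lt_one hρ0.le hρ1).div_const ((ρ ^ k) ^ 2)
    rw [zero_div] at h1
    exact squeeze_zero hw (fun n => min_le_right _ _) h1
  have hw1 : ∀ n, w (n + 1) ≤ ρ⁻¹ * w n := by
    intro n
    rw [mul_min_of_nonneg _ _ (by positivity)]
    apply min_le_min
    · rw [pow_succ, mul_inv, mul_comm]
    · have h1 : 0 ≤ ρ ^ n / (ρ ^ k) ^ 2 := by positivity
      rw [pow_succ, mul_div_right_comm, mul_comm]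
      exact mul_le_mul_of_nonneg_right (hρ1.le.trans hA1) h1
  have hw2 : ∀ n, w n ≤ ρ⁻¹ * w (n + 1) := by
    intro n
    rw [mul_min_of_nonneg _ _ (by positivity)]
    apply min_le_min
    · have h1 : 0 ≤ (ρ ^ n)⁻¹ := by positivity
      rw [pow_succ, mul_inv]
      nlinarith [mul_le_mul_of_nonneg_left hA1 h1, mul_le_mul_of_nonneg_left hA1
        (mul_nonneg h1 (zero_le_one.trans hA1))]
    · apply le_of_eq
      rw [pow_succ]; field_simp; ring
  have hmem : ∀ s, 0 ≤ s → Γ s 0 ∈ Set.Icc (0 : ℝ) 1 :=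
    fun s hs => ⟨hΓ.nonneg hs 0, hΓ.le_one hs 0⟩
  have hM0 : 0 ≤ M := (hM 0 (by simp)).1.trans (hM 0 (by simp)).2
  have hbound : ∀ N ≥ k, geomEnergy ρ (Γ t) k ≤
      gronwallBound K (2 * (ρ⁻¹ * (1 + M + L) * (2 + (1 - ρ)⁻¹))) (2 * (w N * (1 + M + L))) t := by
    intro N hN
    have hstep := le_gronwallBound_of_hasDerivWithinAt_Ici (T := t) (δ := K)
      (c := 2 * (ρ⁻¹ * (1 + M + L) * (2 + (1 - ρ)⁻¹))) (ε := 2 * (w N * (1 + M + L)))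
      (fun s hs => hΓ.hasDerivWithinAt_weightedEnergy ρ w N hs _ _ (fun n => rfl) (fun n => rfl))
      ?_ ?_ t ⟨ht, le_rfl⟩
    · refine le_trans ?_ hstep
      calc geomEnergy ρ (Γ t) k
          = ∑ n ∈ range k, w n * (Γ t n - (1 - ρ) * ρ ^ n) ^ 2 :=
            sum_congr rfl fun n hn => by rw [hwk n (mem_range.1 hn).le]
        _ ≤ _ := sum_le_sum_of_subset_of_nonneg (range_mono (by omega))
            fun n _ _ => mul_nonneg (hw n) (sq_nonneg _)
    · exact (sum_le_sum fun n _ =>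
        mul_le_mul_of_nonneg_right (hwle n) (sq_nonneg _)).trans (hK (N + 1))
    · intro s hs
      have := weightedEnergy_growth hρ0 hρ1 hM0 hL (hM _ (hmem s hs.1)).1 (hM _ (hmem s hs.1)).2
        (fun n => Γ s n - (1 - ρ) * ρ ^ n) w (fun n => ?_) ?_ hw ?_ ?_ hw1 hw2 N
        (J := fun n => (Γ s n - (1 - ρ) * ρ ^ n) - ν * h (Γ s 0) *
          (Γ s (n + 1) - (1 - ρ) * ρ ^ (n + 1)) + (1 - ν * h (Γ s 0) * ρ) * ((1 - ρ) * ρ ^ n))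
        (fun n => rfl)
      · linarith
      · have p0 : 0 ≤ (1 - ρ) * ρ ^ n := mul_nonneg (by linarith) (hρn n).le
        have p1 : (1 - ρ) * ρ ^ n ≤ 1 :=
          mul_le_one₀ (by linarith) (hρn n).le (pow_le_one₀ hρ0.le hρ1.le)
        rw [abs_le]
        constructor <;> linarith [hΓ.nonneg hs.1 n, hΓ.le_one hs.1 n]
      · simpa using hlip _ (hmem s hs.1)
      · simpa using hwk 0 (Nat.zero_le k)
      · intro n
        calc w n * ρ ^ n ≤ (ρ ^ n)⁻¹ * ρ ^ n := mul_le_mul_of_nonneg_right (hwle n) (hρn n).le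
          _ = 1 := inv_mul_cancel₀ (hρn n).ne'
  have hlim : Filter.Tendsto (fun N => 2 * (w N * (1 + M + L))) Filter.atTop (nhds 0) := by
    simpa using (hwlim.mul_const (1 + M + L)).const_mul 2
  exact ge_of_tendsto (tendsto_gronwallBound_of_tendsto_zero hlim)
    (Filter.eventually_atTop.2 ⟨k, hbound⟩)

-- The uniform bound `κ ^ 2` serves twice: it makes the cutoff error `O(1/N)` and the cubic terms a
-- small multiple of the energy.
open Finset in
theorem geomEnergy_decay (hΓ : IsNonlinearMM1Solution ν h Γ) {ρ r β κ q K T : ℝ} (hr : 1 < r)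
    (hρ : ρ * r ^ 2 = 1) (hβ : 0 ≤ β) (hκ : 0 ≤ κ)
    (hlip : ∀ t ∈ Set.Icc 0 T, |1 - ν * h (Γ t 0) * ρ| ≤ β * |Γ t 0 - (1 - ρ)|)
    (hbdd : ∀ t ∈ Set.Icc 0 T, ∀ k, geomEnergy ρ (Γ t) k ≤ κ ^ 2)
    (hq : q ≤ 2 * ((r - 1) ^ 2 - β * r ^ 2 * (1 - ρ) - 2 * r ^ 2 * (β * κ)))
    (hK : ∀ k, geomEnergy ρ (Γ 0) k ≤ K) {t : ℝ} (ht : t ∈ Set.Icc 0 T) (k : ℕ) :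
    geomEnergy ρ (Γ t) k ≤ K * Real.exp (-q * t) := by
  have hρ0 : 0 < ρ := pos_of_mul_pos_left (hρ ▸ one_pos) (by positivity)
  have hρ1 : ρ < 1 := by nlinarith
  have hρn : ∀ n, 0 < ρ ^ n := fun n => pow_pos hρ0 n
  obtain ⟨Q, hQ⟩ : ∃ Q, ∀ k, ∑ n ∈ range k, (n : ℝ) ^ 2 * ρ ^ n ≤ Q :=
    ⟨_, fun k => (summable_pow_mul_geometric_of_norm_lt_one 2
      (by rwa [Real.norm_of_nonneg hρ0.le])).sum_le_tsum _ fun n _ => by positivity⟩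
  set C := 2 * (2 * r ^ 2 * κ ^ 2 + β * κ * r ^ 2 * κ ^ 2 +
    (2 * (r - 1) ^ 2 + β * r ^ 2) * κ * ((κ ^ 2 + Q) / 2)) with hC
  have hbound : ∀ N ≥ k + 1, (1 - (k : ℝ) / N) * geomEnergy ρ (Γ t) k ≤
      gronwallBound K (-q) (C / N) t := by
    intro N hN
    have hN0 : 0 < N := by omega
    have hN' : (0 : ℝ) < N := by exact_mod_cast hN0
    -- Vanishing at `N` kills the boundary flux, monotonicity serves Hardy, and the slope `1/N`
    -- makes the commutator error vanish in the limit.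
    let χ : ℕ → ℝ := fun n => 1 - (n : ℝ) / N
    have hχN : χ N = 0 := by simp [χ, hN'.ne']
    have hχ1 : ∀ n, χ n ≤ 1 := fun n => sub_le_self _ (by positivity)
    have hχ0 : ∀ n ≤ N, 0 ≤ χ n := by
      intro n hn
      rw [sub_nonneg, div_le_one hN']
      exact_mod_cast hn
    have hstep := le_gronwallBound_of_hasDerivWithinAt_Ici (T := T) (δ := K)
      (c := -q) (ε := C / N)
      (fun s hs => hΓ.hasDerivWithinAt_weightedEnergy ρ (fun n => χ n * (ρ ^ n)⁻¹) N hs _ _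
        (fun n => rfl) (fun n => rfl))
      ?_ ?_ t ht
    · refine le_trans ?_ hstep
      unfold geomEnergy
      rw [mul_sum]
      refine (sum_le_sum fun n hn => ?_).trans (sum_le_sum_of_subset_of_nonneg
        (range_mono (by omega : k ≤ N + 1)) fun n hn _ => ?_)
      · rw [mul_assoc]
        apply mul_le_mul_of_nonneg_right _ (mul_nonneg (inv_nonneg.2 (hρn n).le) (sq_nonneg _))
        have : (n : ℝ) ≤ k := by exact_mod_cast (mem_range.1 hn).le
        show _ ≤ 1 - (n : ℝ) / N
        gcongr
      · exact mul_nonneg (mul_nonneg (hχ0 n (Nat.lt_succ_iff.1 (mem_range.1 hn)))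
          (inv_nonneg.2 (hρn n).le)) (sq_nonneg _)
    · refine (sum_le_sum fun n hn => ?_).trans (hK (N + 1))
      rw [mul_assoc]
      exact mul_le_of_le_one_left (mul_nonneg (inv_nonneg.2 (hρn n).le) (sq_nonneg _)) (hχ1 n)
    · intro s hs
      have hs' := Set.Ico_subset_Icc_self hs
      let x : ℕ → ℝ := fun n => (ρ ^ n)⁻¹ * (Γ s n - (1 - ρ) * ρ ^ n)
      have hxu : ∀ n, Γ s n - (1 - ρ) * ρ ^ n = ρ ^ n * x n := fun n =>
        (mul_inv_cancel_left₀ (hρn n).ne' _).symm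
      have hxe : ∀ n, ρ ^ n * x n ^ 2 = (ρ ^ n)⁻¹ * (Γ s n - (1 - ρ) * ρ ^ n) ^ 2 := by
        intro n; rw [hxu]; field_simp
      -- Both laws have mass one; this orthogonality to constants is what makes Hardy yield a
      -- spectral gap.
      have hsum : HasSum (fun n => ρ ^ n * x n) 0 := by
        have := (hΓ.mem_probDist s hs.1).2.sub (hasSum_geometric_law hρ0 hρ1)
        rw [sub_self] at this
        simpa only [hxu] using this
      have hdiss := cutoffEnergy_dissipation (c := 1 - ν * h (Γ s 0) * ρ) (x := x) hr hρ hβ hκ hQ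
        (fun k => by simp only [hxe]; exact hbdd s hs' k) hsum
        (by simpa [x] using hlip s hs') hN0 (χ := χ) (fun n => rfl)
      have hE0 : 0 ≤ ∑ n ∈ range N, χ n * (ρ ^ n * x n ^ 2) := sum_nonneg fun n hn =>
        mul_nonneg (hχ0 n (mem_range.1 hn).le) (mul_nonneg (hρn n).le (sq_nonneg _))
      have h1 : ∑ n ∈ range (N + 1), χ n * (ρ ^ n)⁻¹ * (Γ s n - (1 - ρ) * ρ ^ n) ^ 2 =
          ∑ n ∈ range N, χ n * (ρ ^ n * x n ^ 2) := by
        rw [sum_range_succ, hχN]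
        simp only [hxe]
        simp [mul_assoc]
      have h2 : ∀ n, χ n * (ρ ^ n)⁻¹ * (Γ s n - (1 - ρ) * ρ ^ n) = χ n * x n :=
        fun n => mul_assoc _ _ _
      have h3 : ∀ n, Γ s n - (1 - ρ) * ρ ^ n - ν * h (Γ s 0) *
          (Γ s (n + 1) - (1 - ρ) * ρ ^ (n + 1)) + (1 - ν * h (Γ s 0) * ρ) * ((1 - ρ) * ρ ^ n) =
          ρ ^ n * (x n - x (n + 1) + (1 - ν * h (Γ s 0) * ρ) * x (n + 1)
            + (1 - ν * h (Γ s 0) * ρ) * (1 - ρ)) := by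
        intro n
        rw [hxu, hxu, pow_succ]; ring
      rw [h1]
      simp only [h2, h3, hχN, zero_mul, sub_zero]
      have h4 := mul_le_mul_of_nonneg_right hq hE0
      rw [hC, mul_div_assoc]
      linarith
  have hlimN : Filter.Tendsto (fun N : ℕ => (1 - (k : ℝ) / N) * geomEnergy ρ (Γ t) k)
      Filter.atTop (nhds (geomEnergy ρ (Γ t) k)) := by
    simpa using ((tendsto_const_div_atTop_nhds_zero_nat (k : ℝ)).const_sub 1).mul_const
      (geomEnergy ρ (Γ t) k)
  exact le_of_tendsto_of_tendsto hlimN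
    (tendsto_gronwallBound_of_tendsto_zero (tendsto_const_div_atTop_nhds_zero_nat C))
    (Filter.eventually_atTop.2 ⟨k + 1, hbound⟩)

end IsNonlinearMM1Solution

/-! ### Restarting, and the equilibrium property -/

/-- Exponential decay over unit time for small data propagates to all times. -/
theorem geomEnergy_decay_of_unit_time {ν : ℝ} {h : ℝ → ℝ} {ρ q K₁ : ℝ} (hq : 0 ≤ q)
    (hunit : ∀ Γ : ℝ → ℕ → ℝ, IsNonlinearMM1Solution ν h Γ → ∀ K ≤ K₁,
      (∀ k, geomEnergy ρ (Γ 0) k ≤ K) →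
        ∀ t ∈ Set.Icc (0 : ℝ) 1, ∀ k, geomEnergy ρ (Γ t) k ≤ K * Real.exp (-q * t))
    (n : ℕ) : ∀ Γ : ℝ → ℕ → ℝ, IsNonlinearMM1Solution ν h Γ → ∀ K ≤ K₁,
      (∀ k, geomEnergy ρ (Γ 0) k ≤ K) →
        ∀ t ∈ Set.Icc (0 : ℝ) (n + 1), ∀ k, geomEnergy ρ (Γ t) k ≤ K * Real.exp (-q * t) := by
  induction n with
  | zero => simpa using hunit
  | succ n ih =>
    intro Γ hΓ K hK₁ hK t ht k
    have hK0 : 0 ≤ K := by simpa [geomEnergy] using hK 0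
    rcases le_total t 1 with h1 | h1
    · exact hunit Γ hΓ K hK₁ hK t ⟨ht.1, h1⟩ k
    -- Restart at time `1`, where the energy bound `K * Real.exp (-q)` is still at most `K₁`.
    · have := ih _ (hΓ.shift zero_le_one) (K * Real.exp (-q)) ?_ ?_ (t - 1) ?_ k
      · rw [sub_add_cancel, mul_assoc, ← Real.exp_add] at this
        convert this using 3; ring
      · exact (mul_le_of_le_one_right hK0 (Real.exp_le_one_iff.2 (by linarith))).trans hK₁
      · intro k
        simpa using hunit Γ hΓ K hK₁ hK 1 (by simp) k
      · have := ht.2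
        push_cast at this
        exact ⟨by linarith, by linarith⟩

theorem geometric_law_isEquilibriumPoint {ν : ℝ} {h : ℝ → ℝ} {ρ : ℝ} (hρ0 : 0 < ρ) (hρ1 : ρ < 1)
    (hfix : ν * h (1 - ρ) * ρ = 1) : IsEquilibriumPoint ν h (fun n => (1 - ρ) * ρ ^ n) where
  mem_probDist _ _ :=
    ⟨fun n => mul_nonneg (by linarith) (pow_nonneg hρ0.le n), hasSum_geometric_law hρ0 hρ1⟩
  hasDeriv f _ hs t _ := by
    have hfin : ∀ g : ℕ → ℝ, g.support.Finite → ∀ μ : ℕ → ℝ, Summable fun n => μ n * g n :=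
      fun g hg μ => summable_of_hasFiniteSupport
        (hg.subset (Function.support_mul_subset_right μ g))
    have hs1 : (fun n => f (n + 1)).support.Finite :=
      hs.preimage (Set.injOn_of_injective (add_left_injective 1))
    have hs2 : (fun n => f (n - 1)).support.Finite := by
      refine ((hs.image Nat.succ).union (Set.finite_singleton 0)).subset fun n hn => ?_
      rcases n with _ | n
      · exact Or.inr rfl
      · exact Or.inl ⟨n, hn, rfl⟩
    have hp : (gradPlus f).support.Finite := (hs1.union hs).subset (Function.support_sub _ _)
    have hm : (gradMinus f).support.Finite := by
      refine (hs2.union hs).subset fun n hn => Function.support_sub _ _ ?_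
      intro h0
      exact hn (by unfold gradMinus; split_ifs; exacts [h0, rfl])
    have hzero : pairing (fun n => (1 - ρ) * ρ ^ n) (gradPlus f) +
        ν * h (1 - ρ) * pairing (fun n => (1 - ρ) * ρ ^ n) (gradMinus f) = 0 := by
      have hsum := hfin _ hm fun n => (1 - ρ) * ρ ^ n
      have hsum' := (summable_nat_add_iff 1).2 hsum
      -- Shifting by one pairs the jump `n + 1 → n` with `n → n + 1`; detailed balance then cancels
      -- term by term.
      have h1 : pairing (fun n => (1 - ρ) * ρ ^ n) (gradMinus f) =
          ∑' n, (1 - ρ) * ρ ^ (n + 1) * gradMinus f (n + 1) := by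
        unfold pairing
        rw [hsum.tsum_eq_zero_add]
        simp [gradMinus]
      rw [h1, pairing, ← tsum_mul_left, ← (hfin _ hp _).tsum_add (hsum'.mul_left _)]
      refine (tsum_congr fun n => ?_).trans tsum_zero
      simp only [gradPlus, gradMinus, Nat.succ_pos, if_true, Nat.add_sub_cancel]
      rw [pow_succ]
      linear_combination (1 - ρ) * ρ ^ n * (f n - f (n + 1)) * hfix
    simp only [pow_zero, mul_one, hzero]
    exact hasDerivWithinAt_const _ _ _

/-! ### From the energy to the weighted distance -/

theorem l2Dist_sq (μ π : ℕ → ℝ) :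
    l2Dist μ π ^ 2 = ∑' n, ENNReal.ofReal ((μ n / π n - 1) ^ 2 * π n) := by
  unfold l2Dist
  rw [← ENNReal.rpow_natCast, ← ENNReal.rpow_mul]
  norm_num

theorem deviation_geometric_law {ρ : ℝ} (hρ0 : 0 < ρ) (hρ1 : ρ < 1) (a : ℝ) (n : ℕ) :
    (a / ((1 - ρ) * ρ ^ n) - 1) ^ 2 * ((1 - ρ) * ρ ^ n) =
      (1 - ρ)⁻¹ * ((ρ ^ n)⁻¹ * (a - (1 - ρ) * ρ ^ n) ^ 2) := by
  have h1 : 1 - ρ ≠ 0 := by linarith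
  have h2 : ρ ^ n ≠ 0 := (pow_pos hρ0 n).ne'
  field_simp

theorem ofReal_geomEnergy {ρ : ℝ} (hρ0 : 0 < ρ) (hρ1 : ρ < 1) (μ : ℕ → ℝ) (k : ℕ) :
    ENNReal.ofReal ((1 - ρ)⁻¹ * geomEnergy ρ μ k) = ∑ n ∈ Finset.range k,
      ENNReal.ofReal ((μ n / ((1 - ρ) * ρ ^ n) - 1) ^ 2 * ((1 - ρ) * ρ ^ n)) := by
  rw [← ENNReal.ofReal_sum_of_nonneg, geomEnergy, Finset.mul_sum]
  · simp only [deviation_geometric_law hρ0 hρ1]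
  · intro n _
    exact mul_nonneg (sq_nonneg _) (mul_nonneg (by linarith) (pow_nonneg hρ0.le n))

theorem geomEnergy_le_of_l2Dist {ρ : ℝ} (hρ0 : 0 < ρ) (hρ1 : ρ < 1) {μ : ℕ → ℝ}
    (hfin : l2Dist μ (fun n => (1 - ρ) * ρ ^ n) ^ 2 ≠ ⊤) (k : ℕ) :
    geomEnergy ρ μ k ≤ (1 - ρ) * (l2Dist μ (fun n => (1 - ρ) * ρ ^ n) ^ 2).toReal := by
  have h1 : ENNReal.ofReal ((1 - ρ)⁻¹ * geomEnergy ρ μ k) ≤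
      l2Dist μ (fun n => (1 - ρ) * ρ ^ n) ^ 2 := by
    rw [ofReal_geomEnergy hρ0 hρ1, l2Dist_sq]
    exact ENNReal.sum_le_tsum _
  rw [ENNReal.ofReal_le_iff_le_toReal hfin, inv_mul_le_iff₀ (by linarith)] at h1
  exact h1

theorem l2Dist_sq_le_of_geomEnergy {ρ K : ℝ} (hρ0 : 0 < ρ) (hρ1 : ρ < 1) {μ : ℕ → ℝ}
    (hK : ∀ k, geomEnergy ρ μ k ≤ K) :
    l2Dist μ (fun n => (1 - ρ) * ρ ^ n) ^ 2 ≤ ENNReal.ofReal ((1 - ρ)⁻¹ * K) := by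
  rw [l2Dist_sq]
  refine ENNReal.tsum_le_of_sum_range_le fun k => ?_
  rw [← ofReal_geomEnergy hρ0 hρ1]
  exact ENNReal.ofReal_le_ofReal (mul_le_mul_of_nonneg_left (hK k) (inv_nonneg.2 (by linarith)))

/-! ### Choice of constants and conclusion -/

/-- Local exponential decay of the energy when the slope of `h` at `1 - ρ` is below the spectral
gap. -/
theorem exists_geomEnergy_exp_decay {ν : ℝ} (hν : 0 < ν) {h : ℝ → ℝ}
    (hC1 : ContDiffOn ℝ 1 h (Set.Icc 0 1)) (h_one_le : ∀ x ∈ Set.Icc (0 : ℝ) 1, 1 ≤ h x)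
    {ρ r : ℝ} (hr : 1 < r) (hρ : ρ * r ^ 2 = 1) (hfix : ν * h (1 - ρ) * ρ = 1)
    (hderiv : ν * (1 - ρ) * |derivWithin h (Set.Icc 0 1) (1 - ρ)| < (r - 1) ^ 2) :
    ∃ q > 0, ∃ K₁ > 0, ∀ Γ : ℝ → ℕ → ℝ, IsNonlinearMM1Solution ν h Γ → ∀ K ≤ K₁,
      (∀ k, geomEnergy ρ (Γ 0) k ≤ K) → ∀ t, 0 ≤ t → ∀ k,
        geomEnergy ρ (Γ t) k ≤ K * Real.exp (-q * t) := by
  have hρ0 : 0 < ρ := pos_of_mul_pos_left (hρ ▸ one_pos) (by positivity)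
  have hρ1 : ρ < 1 := by nlinarith
  set S := 1 - ρ with hS
  have hS0 : 0 < S := by linarith
  have hSmem : S ∈ Set.Icc (0 : ℝ) 1 := ⟨hS0.le, by linarith⟩
  set g := (r - 1) ^ 2 - ν * S * |derivWithin h (Set.Icc 0 1) S| with hg
  have hg0 : 0 < g := by linarith
  -- The global Lipschitz constant only enters the crude growth bound; the sharp estimate uses the
  -- slope at `S`.
  obtain ⟨L, hL⟩ := hC1.exists_lipschitzOnWith one_ne_zero (convex_Icc 0 1) isCompact_Icc
  obtain ⟨M, hM⟩ := isCompact_Icc.exists_bound_of_continuousOn hC1.continuousOn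
  have hrate : ∀ y, 1 - ν * h y * ρ = ν * ρ * (h S - h y) := fun y => by linarith
  have hνρ : 0 ≤ ν * ρ := by positivity
  have hlip : ∀ y ∈ Set.Icc (0 : ℝ) 1, |1 - ν * h y * ρ| ≤ ν * ρ * L * |y - S| := by
    intro y hy
    have := hL.dist_le_mul y hy S hSmem
    rw [Real.dist_eq, Real.dist_eq] at this
    rw [hrate, abs_mul, abs_of_nonneg hνρ, abs_sub_comm, mul_assoc (ν * ρ)]
    exact mul_le_mul_of_nonneg_left this hνρ
  have hMν : ∀ y ∈ Set.Icc (0 : ℝ) 1, 0 ≤ ν * h y ∧ ν * h y ≤ ν * M := by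
    intro y hy
    have h1 := h_one_le y hy
    exact ⟨by positivity, mul_le_mul_of_nonneg_left ((le_abs_self _).trans (hM y hy)) hν.le⟩
  have hM0 : 0 ≤ ν * M := (hMν S hSmem).1.trans (hMν S hSmem).2
  set C := 2 * (ρ⁻¹ * (1 + ν * M + ν * ρ * L) * (2 + S⁻¹)) with hC
  have hC0 : 0 ≤ C := by positivity
  -- The margin `g` is split: a quarter for the error in the slope of `h`, a quarter for the cubic
  -- terms through `κ`. The remaining half is doubled by differentiating a square, giving `q = g`.
  set η := g / (4 * (ν * S)) with hη
  have hη0 : 0 < η := by positivity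
  set β := ν * ρ * (|derivWithin h (Set.Icc 0 1) S| + η) with hβ
  have hβ0 : 0 ≤ β := by positivity
  have hderivAt : HasDerivAt h (derivWithin h (Set.Icc 0 1) S) S :=
    (hC1.differentiableOn one_ne_zero S hSmem).hasDerivWithinAt.hasDerivAt
      (Icc_mem_nhds hS0 (by linarith))
  obtain ⟨d, hd0, hd⟩ := Metric.eventually_nhds_iff.1
    ((hasDerivAt_iff_isLittleO.1 hderivAt).def hη0)
  have hslope : ∀ y, |y - S| < d → |1 - ν * h y * ρ| ≤ β * |y - S| := by
    intro y hy
    have h1 := hd (y := y) (by rwa [Real.dist_eq])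
    rw [smul_eq_mul, Real.norm_eq_abs, Real.norm_eq_abs] at h1
    rw [hrate, abs_mul, abs_of_nonneg hνρ, abs_sub_comm, hβ, mul_assoc (ν * ρ)]
    refine mul_le_mul_of_nonneg_left ?_ hνρ
    have h2 := abs_add_le (h y - h S - (y - S) * derivWithin h (Set.Icc 0 1) S)
      ((y - S) * derivWithin h (Set.Icc 0 1) S)
    rw [sub_add_cancel, abs_mul (y - S)] at h2
    linarith
  obtain ⟨κ, hκ0, hκd, hκg⟩ : ∃ κ > 0, κ < d ∧ 2 * r ^ 2 * (β * κ) ≤ g / 4 := by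
    have hden : 0 < 2 * r ^ 2 * β + 1 := by positivity
    refine ⟨min (d / 2) (g / 4 / (2 * r ^ 2 * β + 1)), by positivity,
      (min_le_left _ _).trans_lt (by linarith), ?_⟩
    have h1 : min (d / 2) (g / 4 / (2 * r ^ 2 * β + 1)) * (2 * r ^ 2 * β + 1) ≤ g / 4 :=
      (le_div_iff₀ hden).1 (min_le_right _ _)
    have h2 : 0 ≤ min (d / 2) (g / 4 / (2 * r ^ 2 * β + 1)) := by positivity
    linarith
  -- Crude growth over unit time multiplies the energy by at most `Real.exp C`, so it stays below `κ
  -- ^ 2`.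
  refine ⟨g, hg0, κ ^ 2 * Real.exp (-C), by positivity, fun Γ hΓ K hK₁ hK t ht k => ?_⟩
  refine geomEnergy_decay_of_unit_time hg0.le ?_ ⌈t⌉₊ Γ hΓ K hK₁ hK t
    ⟨ht, (Nat.le_ceil t).trans (by linarith)⟩ k
  intro Γ hΓ K hK₁ hK t ht k
  have hK0 : 0 ≤ K := by simpa [geomEnergy] using hK 0
  have hbdd : ∀ t ∈ Set.Icc (0 : ℝ) 1, ∀ k, geomEnergy ρ (Γ t) k ≤ κ ^ 2 := by
    intro t ht k
    refine (hΓ.geomEnergy_growth hρ0 hρ1 hMν (by positivity) hlip hK ht.1 k).trans ?_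
    calc K * Real.exp (C * t) ≤ κ ^ 2 * Real.exp (-C) * Real.exp C := by
          refine mul_le_mul hK₁ (Real.exp_le_exp.2 ?_) (Real.exp_pos _).le (by positivity)
          nlinarith [ht.2]
      _ = κ ^ 2 := by rw [mul_assoc, ← Real.exp_add, neg_add_cancel, Real.exp_zero, mul_one]
  refine hΓ.geomEnergy_decay hr hρ hβ0 hκ0.le ?_ hbdd ?_ hK ht k
  · intro s hs
    apply hslope
    refine lt_of_le_of_lt (abs_le_of_sq_le_sq ?_ hκ0.le) hκd
    simpa [geomEnergy] using hbdd s hs 1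
  · have h1 : β * r ^ 2 * (1 - ρ) = ν * S * |derivWithin h (Set.Icc 0 1) S| + g / 4 := by
      have h2 : ν * S * η = g / 4 := by rw [hη]; field_simp
      rw [← h2, hβ, ← hS]
      linear_combination ν * S * (|derivWithin h (Set.Icc 0 1) S| + η) * hρ
    rw [h1]
    linarith

theorem mainTheorem5 (ν : ℝ) (hν : 0 < ν) (h : ℝ → ℝ)
    (hC1 : ContDiffOn ℝ 1 h (Set.Icc 0 1)) (h_one_le : ∀ x ∈ Set.Icc (0 : ℝ) 1, 1 ≤ h x)
    (S : ℝ) (hS : S ∈ Set.Ioo (0 : ℝ) 1) (hfix : S = 1 - 1 / (ν * h S))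
    (hderiv : |derivWithin h (Set.Icc 0 1) S| <
      1 / (ν * S) * (1 / Real.sqrt (1 - S) - 1) ^ 2) :
    IsExponentiallyStableEquilibrium ν h (piS ν h S) := by
  obtain ⟨hS0, hS1⟩ := hS
  have hhS := h_one_le S ⟨hS0.le, hS1.le⟩
  have hνh : 0 < ν * h S := by positivity
  obtain ⟨ρ, hρS⟩ : ∃ ρ, ρ = 1 - S := ⟨_, rfl⟩
  obtain rfl : S = 1 - ρ := by linarith
  have hρ0 : 0 < ρ := by linarith
  have hρ1 : ρ < 1 := by linarith
  have hρinv : 1 / (ν * h (1 - ρ)) = ρ := by linarith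
  have hfix' : ν * h (1 - ρ) * ρ = 1 := by
    rw [one_div] at hρinv
    calc ν * h (1 - ρ) * ρ = ν * h (1 - ρ) * (ν * h (1 - ρ))⁻¹ := by rw [hρinv]
      _ = 1 := mul_inv_cancel₀ hνh.ne'
  have hπ : piS ν h (1 - ρ) = fun n => (1 - ρ) * ρ ^ n := by
    funext n
    rw [piS, hρinv, mul_comm]
  rw [sub_sub_cancel] at hderiv
  have hsq : 0 < Real.sqrt ρ := Real.sqrt_pos.2 hρ0
  have hr : 1 < 1 / Real.sqrt ρ := by
    rw [lt_div_iff₀ hsq, one_mul, Real.sqrt_lt' one_pos]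
    linarith
  have hr2 : ρ * (1 / Real.sqrt ρ) ^ 2 = 1 := by
    rw [div_pow, Real.sq_sqrt hρ0.le, one_pow, mul_one_div_cancel hρ0.ne']
  have hderiv' : ν * (1 - ρ) * |derivWithin h (Set.Icc 0 1) (1 - ρ)| <
      (1 / Real.sqrt ρ - 1) ^ 2 := by
    rw [one_div_mul_eq_div, lt_div_iff₀ (by positivity)] at hderiv
    linarith
  obtain ⟨q, hq, K₁, hK₁, hdecay⟩ :=
    exists_geomEnergy_exp_decay hν hC1 h_one_le hr hr2 hfix' hderiv'
  rw [hπ]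
  refine ⟨geometric_law_isEquilibriumPoint hρ0 hρ1 hfix', q, hq, Real.sqrt K₁,
    Real.sqrt_pos.2 hK₁, fun Γ hΓ hε t ht => ?_⟩
  set T := l2Dist (Γ 0) (fun n => (1 - ρ) * ρ ^ n) ^ 2 with hT
  have hTK : T ≤ ENNReal.ofReal K₁ := by
    calc T ≤ ENNReal.ofReal (Real.sqrt K₁) ^ 2 := pow_le_pow_left' hε 2
      _ = ENNReal.ofReal K₁ := by
        rw [← ENNReal.ofReal_pow (Real.sqrt_nonneg _), Real.sq_sqrt hK₁.le]
  have hTfin : T ≠ ⊤ := ne_top_of_le_ne_top ENNReal.ofReal_ne_top hTK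
  have hTK' : T.toReal ≤ K₁ := ENNReal.toReal_le_of_le_ofReal hK₁.le hTK
  have hT0 : 0 ≤ T.toReal := ENNReal.toReal_nonneg
  -- The energy bound carries the factor `1 - ρ < 1`, so the radius `√K₁` is small enough.
  have hfinal := hdecay Γ hΓ ((1 - ρ) * T.toReal) (by nlinarith)
    (geomEnergy_le_of_l2Dist hρ0 hρ1 hTfin) t ht
  refine (l2Dist_sq_le_of_geomEnergy hρ0 hρ1 hfinal).trans_eq ?_
  rw [← mul_assoc, ← mul_assoc, inv_mul_cancel₀ hS0.ne', one_mul, ENNReal.ofReal_mul hT0,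
    ENNReal.ofReal_toReal hTfin]
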